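/- For a function $h:\mathbb Z\to\mathbb Z_{\ge 0}$, not identically zero, with $h(j)=0$ for $j\ll 0$, let $k_0=\min\{k : h(k)\neq 0\}$ and, for $d,k\in\mathbb Z$, put $$\beta^d_k(h)=\sum_{j=k_0}^{k}(-1)^{k-j}\binom{d-j}{k-j}h(j)\ \text{ if } k_0\le k\le d,\qquad \beta^d_k(h)=0\ \text{ otherwise.}$$ The Hilbert depth of $h$ is $$\operatorname{qdepth}(h)=\max\{d\in\mathbb Z : \beta^d_k(h)\ge 0 \text{ for all } k\le d\}.$$ Let $K$ be a field, $n\ge 0$, and let $S=K[x_1,\ldots,x_n]$ with the standard grading. For a homogeneous ideal $J\subset S$ let $h_{S/J}(k)=\dim_K (S/J)_k$, $k\in\mathbb Z$, be the Hilbert function of $S/J$, and let $h_S(k)=\dim_K S_k$. Let $0\le r\le n$ and let $J=(f_1,\ldots,f_r)\subset S$ be a graded complete intersection, that is, $f_1,\ldots,f_r$ are homogeneous polynomials that form a regular sequence in $S$. If $\deg(f_i)\ge 2$ for all $1\le i\le r$, then the maximum defining $\operatorname{qdepth}(h_{S/J})$ exists and $$\operatorname{qdepth}(h_{S/J})=n.$$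 In particular, $\operatorname{qdepth}(h_S)=n$ (the case $r=0$). -/

import Mathlib

open MvPolynomial

noncomputable section

/-- The initial degree `k₀(h) = min {k : h k ≠ 0}` of a numerical function `h : ℤ → ℤ_{≥ 0}`
that is nonzero and vanishes in all sufficiently negative degrees. -/
def initialDegree (h : ℤ → ℕ) : ℤ :=
  sInf {k : ℤ | h k ≠ 0}

/-- `β^d_k(h) = ∑_{j = k₀(h)}^{k} (-1)^{k-j} * binom (d-j) (k-j) * h j` if `k₀(h) ≤ k ≤ d`, and
`0` otherwise. In the sum `j ≤ k ≤ d`, so `k - j` and `d - j` are natural numbers. -/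
def hilbertBeta (h : ℤ → ℕ) (d k : ℤ) : ℤ :=
  if initialDegree h ≤ k ∧ k ≤ d then
    ∑ j ∈ Finset.Icc (initialDegree h) k,
      (-1 : ℤ) ^ (k - j).toNat * ((d - j).toNat.choose (k - j).toNat : ℤ) * (h j : ℤ)
  else 0

/-- The integers `d` with `β^d_k(h) ≥ 0` for all `k ≤ d`; the Hilbert depth is their maximum. -/
def hilbertDepthSet (h : ℤ → ℕ) : Set ℤ :=
  {d : ℤ | ∀ k : ℤ, k ≤ d → 0 ≤ hilbertBeta h d k}

/-- The Hilbert depth `qdepth(h)`. It is the maximum of `hilbertDepthSet h` when that maximum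
exists, that is, when `IsGreatest (hilbertDepthSet h) (qdepth h)`. -/
def qdepth (h : ℤ → ℕ) : ℤ :=
  sSup (hilbertDepthSet h)

/-- The Hilbert function `k ↦ dim_K M_k` of a `K`-vector space with homogeneous components
`M_k`, `k ∈ ℤ` (used only when all of them are finite-dimensional). -/
def hilbertFunction {K M : Type*} [Field K] [AddCommGroup M] [Module K M]
    (𝓜 : ℤ → Submodule K M) (k : ℤ) : ℕ :=
  Module.finrank K (𝓜 k)

/-- The standard `ℤ`-grading of `S = K[x_1, …, x_n]`: `S_k` is the space of homogeneous
polynomials of degree `k` if `k ≥ 0`, and zero if `k < 0`. -/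
def polyGrading (K : Type*) [Field K] (n : ℕ) (k : ℤ) :
    Submodule K (MvPolynomial (Fin n) K) :=
  if 0 ≤ k then homogeneousSubmodule (Fin n) K k.toNat else ⊥

/-- The components of `S/J`: `(S/J)_k` is the image of `S_k`. -/
def quotientGrading {K : Type*} [Field K] {n : ℕ} (J : Ideal (MvPolynomial (Fin n) K)) (k : ℤ) :
    Submodule K (MvPolynomial (Fin n) K ⧸ J) :=
  (polyGrading K n k).map (Ideal.Quotient.mkₐ K J).toLinearMap

/-- `J = (f_1, …, f_r)` is a graded complete intersection: the `f_i` are homogeneous polynomials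
that form a regular sequence in `S` and generate `J`. -/
structure IsGradedCompleteIntersection {K : Type*} [Field K] {n r : ℕ}
    (J : Ideal (MvPolynomial (Fin n) K)) (f : Fin r → MvPolynomial (Fin n) K) : Prop where
  span_eq : J = Ideal.span (Set.range f)
  homogeneous : ∀ i, (f i).IsHomogeneous (f i).totalDegree
  regular : RingTheory.Sequence.IsRegular (MvPolynomial (Fin n) K) (List.ofFn f)

end

/-! If `h` starts in degree 0 and has generating series `H`, then `β^d_k(h)` is the coefficient of
`X^k` in `H (1 + X)^{-(d-k+1)}`. For a complete intersection, `H = (1 - X)^{-n} ∏ (1 - X^{d_i})`. As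
`d_i ≥ 2`, this is a product of `n` factors `1 + X + X^2 R` with `R ≥ 0` coefficientwise. Each such
factor raises the admissible `d` by one (`HasPositiveBeta.mul`): `1 + X` cancels one power of `(1 +
X)^{-1}`, and `X^2 R` adds a nonnegative combination of earlier `β`s. So `d = n` is admissible.
Nothing larger is, because `β^d_1 = h(1) - d h(0) = n - d`. -/

/-! ### Positivity of `β` under multiplication of power series -/

/-- The power series `(1 + X)^{-(m+1)}`. -/
noncomputable def invOneAddPow (m : ℕ) : PowerSeries ℤ :=
  PowerSeries.mk fun i => (-1) ^ i * ((m + i).choose i : ℤ)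

theorem one_add_X_mul_invOneAddPow_succ (m : ℕ) :
    (1 + PowerSeries.X) * invOneAddPow (m + 1) = invOneAddPow m := by
  ext i
  rw [add_mul, one_mul, map_add]
  cases i with
  | zero => simp [invOneAddPow]
  | succ i =>
    rw [PowerSeries.coeff_succ_X_mul]
    simp only [invOneAddPow, PowerSeries.coeff_mk]
    rw [show m + 1 + (i + 1) = (m + 1 + i) + 1 by ring, Nat.choose_succ_succ',
      show m + (i + 1) = m + 1 + i by ring]
    push_cast
    ring

theorem one_add_X_mul_invOneAddPow_zero :
    (1 + PowerSeries.X) * invOneAddPow 0 = 1 := by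
  ext i
  rw [add_mul, one_mul, map_add]
  cases i with
  | zero => simp [invOneAddPow]
  | succ i =>
    rw [PowerSeries.coeff_succ_X_mul]
    simp [invOneAddPow, pow_succ, PowerSeries.coeff_one]

/-- The power series `f` has nonnegative coefficients, starts with `1 + d X`, and satisfies
`β^d_k(f) ≥ 0` for all `k ≤ d`, where `β^d_k(f)` is the coefficient of `X^k` in
`f (1 + X)^{-(d-k+1)}`. -/
structure HasPositiveBeta (d : ℕ) (f : PowerSeries ℤ) : Prop where
  coeff_nonneg : ∀ k, 0 ≤ PowerSeries.coeff k f
  coeff_zero : PowerSeries.coeff 0 f = 1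
  coeff_one : PowerSeries.coeff 1 f = d
  beta_nonneg : ∀ k m, k + m = d → 0 ≤ PowerSeries.coeff k (f * invOneAddPow m)

/-- Pascal's rule gives `β^d_{k+1} = β^{d+1}_{k+1} + β^d_k`; induct on `k`. -/
theorem beta_nonneg_pred {f : PowerSeries ℤ} {d : ℕ}
    (h : ∀ k m, k + m = d + 1 → 0 ≤ PowerSeries.coeff k (f * invOneAddPow m)) :
    ∀ k m, k + m = d → 0 ≤ PowerSeries.coeff k (f * invOneAddPow m) := by
  intro k
  induction k with
  | zero =>
    intro m hm
    have := h 0 (m + 1) (by omega)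
    simpa [invOneAddPow] using this
  | succ k ih =>
    intro m hm
    rw [← one_add_X_mul_invOneAddPow_succ, add_mul, one_mul, mul_add, mul_left_comm, map_add,
      PowerSeries.coeff_succ_X_mul]
    exact add_nonneg (h _ _ (by omega)) (ih _ (by omega))

theorem beta_nonneg_of_le {f : PowerSeries ℤ} {d e : ℕ} (hed : e ≤ d)
    (h : ∀ k m, k + m = d → 0 ≤ PowerSeries.coeff k (f * invOneAddPow m)) :
    ∀ k m, k + m = e → 0 ≤ PowerSeries.coeff k (f * invOneAddPow m) := by
  induction d, hed using Nat.le_induction with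
  | base => exact h
  | succ d _ ih => exact ih (beta_nonneg_pred h)

theorem PowerSeries.coeff_mul_nonneg {f g : PowerSeries ℤ} {N : ℕ}
    (hf : ∀ k, 0 ≤ PowerSeries.coeff k f) (hg : ∀ k ≤ N, 0 ≤ PowerSeries.coeff k g) :
    0 ≤ PowerSeries.coeff N (f * g) := by
  rw [PowerSeries.coeff_mul]
  refine Finset.sum_nonneg fun p hp => mul_nonneg (hf _) (hg _ ?_)
  rw [Finset.HasAntidiagonal.mem_antidiagonal] at hp
  omega

theorem hasPositiveBeta_one : HasPositiveBeta 0 1 where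
  coeff_nonneg k := by
    rw [PowerSeries.coeff_one]
    split_ifs <;> simp
  coeff_zero := by simp
  coeff_one := by simp [PowerSeries.coeff_one]
  beta_nonneg k m hkm := by
    obtain ⟨rfl, rfl⟩ : k = 0 ∧ m = 0 := by omega
    simp [invOneAddPow]

theorem HasPositiveBeta.mul {d : ℕ} {f R : PowerSeries ℤ} (hf : HasPositiveBeta d f)
    (hR : ∀ k, 0 ≤ PowerSeries.coeff k R) :
    HasPositiveBeta (d + 1) (f * (1 + PowerSeries.X + PowerSeries.X ^ 2 * R)) where
  coeff_nonneg k := by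
    refine PowerSeries.coeff_mul_nonneg hf.coeff_nonneg fun j _ => ?_
    rw [map_add, map_add, PowerSeries.coeff_one, PowerSeries.coeff_X, PowerSeries.coeff_X_pow_mul']
    have := hR (j - 2)
    split_ifs <;> linarith
  coeff_zero := by
    have := hf.coeff_zero
    simpa using this
  coeff_one := by
    have h0 := hf.coeff_zero
    have h1 := hf.coeff_one
    rw [mul_add, mul_add, mul_one, map_add, map_add, h1, mul_left_comm,
      PowerSeries.coeff_X_pow_mul', PowerSeries.coeff_succ_mul_X, h0]
    simp
  beta_nonneg k m hkm := by
    rw [mul_add, add_mul, map_add]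
    refine add_nonneg ?_ ?_
    · cases m with
      | zero =>
        -- In the top degree `k = d + 1` the cancellation leaves a coefficient of `f` itself, which
        -- is why `coeff_nonneg` is carried along.
        rw [mul_assoc, one_add_X_mul_invOneAddPow_zero, mul_one]
        exact hf.coeff_nonneg k
      | succ m =>
        rw [mul_assoc, one_add_X_mul_invOneAddPow_succ]
        exact hf.beta_nonneg k m (by omega)
    -- With `m` fixed, the terms are `β^{j+m}_j(f)` for `j ≤ k - 2`, so `j + m < d`.
    · rw [show f * (PowerSeries.X ^ 2 * R) * invOneAddPow m =
        PowerSeries.X ^ 2 * (R * (f * invOneAddPow m)) by ring, PowerSeries.coeff_X_pow_mul']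
      split_ifs with h2
      · refine PowerSeries.coeff_mul_nonneg hR fun j hj => ?_
        exact beta_nonneg_of_le (e := j + m) (by omega) hf.beta_nonneg j m rfl
      · exact le_rfl

/-! ### Hilbert depth read off from the generating series -/

/-- The generating series `∑_{k ≥ 0} h(k) X^k`. -/
noncomputable def generatingSeries (h : ℤ → ℕ) : PowerSeries ℤ :=
  PowerSeries.mk fun k => (h k : ℤ)

theorem initialDegree_eq_zero {h : ℤ → ℕ} (hneg : ∀ k < 0, h k = 0) (h0 : h 0 ≠ 0) :
    initialDegree h = 0 := by
  refine IsLeast.csInf_eq ⟨h0, fun k hk => ?_⟩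
  by_contra hlt
  exact hk (hneg k (not_le.mp hlt))

theorem hilbertBeta_eq_coeff {h : ℤ → ℕ} (h0 : initialDegree h = 0) (k m : ℕ) :
    hilbertBeta h ((k + m : ℕ) : ℤ) k =
      PowerSeries.coeff k (generatingSeries h * invOneAddPow m) := by
  rw [hilbertBeta, h0, if_pos (by constructor <;> push_cast <;> omega), PowerSeries.coeff_mul,
    Finset.Nat.sum_antidiagonal_eq_sum_range_succ_mk]
  symm
  refine Finset.sum_bij (fun (i : ℕ) _ => (i : ℤ)) ?_ ?_ ?_ ?_
  · intro i hi
    simp only [Finset.mem_range, Finset.mem_Icc] at hi ⊢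
    omega
  · intro i _ j _ hij
    exact_mod_cast hij
  · intro j hj
    simp only [Finset.mem_Icc] at hj
    exact ⟨j.toNat, by simp only [Finset.mem_range]; omega, by omega⟩
  · intro i hi
    simp only [Finset.mem_range] at hi
    simp only [generatingSeries, invOneAddPow, PowerSeries.coeff_mk]
    rw [show ((k : ℤ) - i).toNat = k - i by omega,
      show (((k + m : ℕ) : ℤ) - i).toNat = m + (k - i) by omega]
    ring

theorem isGreatest_hilbertDepthSet {h : ℤ → ℕ} {n : ℕ} (hneg : ∀ k < 0, h k = 0)
    (hn : HasPositiveBeta n (generatingSeries h)) :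
    IsGreatest (hilbertDepthSet h) (n : ℤ) := by
  have h0 : h 0 = 1 := by simpa [generatingSeries] using hn.coeff_zero
  have h1 : PowerSeries.coeff 1 (generatingSeries h) = n := hn.coeff_one
  have hinit : initialDegree h = 0 := initialDegree_eq_zero hneg (by simp [h0])
  constructor
  · intro k hk
    by_cases hk0 : 0 ≤ k
    · lift k to ℕ using hk0
      obtain ⟨m, rfl⟩ := Nat.exists_eq_add_of_le (Int.ofNat_le.mp hk)
      rw [hilbertBeta_eq_coeff hinit]
      exact hn.beta_nonneg k m rfl
    · rw [hilbertBeta, if_neg (by omega)]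
  · intro d hd
    by_contra! hlt
    -- `d > n ≥ 0` forces `d ≥ 1`, so `β^d_1` is given by the sum and equals `n - d < 0`.
    obtain ⟨m, rfl⟩ : ∃ m : ℕ, d = ((1 + m : ℕ) : ℤ) := ⟨(d - 1).toNat, by omega⟩
    have hβ := hd ((1 : ℕ) : ℤ) (by omega)
    rw [hilbertBeta_eq_coeff hinit, PowerSeries.coeff_mul,
      Finset.Nat.sum_antidiagonal_eq_sum_range_succ_mk] at hβ
    simp [Finset.sum_range_succ, h1, hn.coeff_zero, invOneAddPow] at hβ
    push_cast at hlt
    omega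

/-! ### Hilbert series of graded complete intersections -/

section HilbertSeries

attribute [local instance] MvPolynomial.gradedAlgebra

variable {K : Type*} [Field K] {n : ℕ}

instance finite_polyGrading (k : ℤ) : Module.Finite K (polyGrading K n k) := by
  refine Module.Finite.iff_fg.mpr ?_
  rw [polyGrading]
  split_ifs
  · exact homogeneousSubmodule_fg _ _ _
  · exact Submodule.fg_bot

theorem polyGrading_of_neg {k : ℤ} (hk : k < 0) : polyGrading K n k = ⊥ :=
  if_neg (not_le.mpr hk)

theorem polyGrading_natCast (k : ℕ) : polyGrading K n k = homogeneousSubmodule (Fin n) K k := by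
  simp [polyGrading]

theorem finrank_homogeneousSubmodule (k : ℕ) :
    Module.finrank K (homogeneousSubmodule (Fin n) K k) = n.multichoose k := by
  rw [homogeneousSubmodule_eq_finsupp_supported]
  have hset : {d : Fin n →₀ ℕ | d.degree = k} =
      ((Finset.univ : Finset (Fin n)).finsuppAntidiag k : Set (Fin n →₀ ℕ)) := by
    ext d
    simp [Finsupp.degree_eq_sum]
  rw [hset, (AddMonoidAlgebra.supportedEquivFinsupp _).finrank_eq, Module.finrank_finsupp_self]
  simp [Finset.card_finsuppAntidiag_nat_eq_multichoose]

theorem hilbertFunction_polyGrading_of_neg {k : ℤ} (hk : k < 0) :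
    hilbertFunction (polyGrading K n) k = 0 := by
  rw [hilbertFunction, polyGrading_of_neg hk, finrank_bot]

theorem hilbertFunction_quotientGrading_of_neg (J : Ideal (MvPolynomial (Fin n) K)) {k : ℤ}
    (hk : k < 0) : hilbertFunction (quotientGrading J) k = 0 := by
  rw [hilbertFunction, quotientGrading, polyGrading_of_neg hk, Submodule.map_bot, finrank_bot]

theorem generatingSeries_polyGrading :
    generatingSeries (hilbertFunction (polyGrading K n)) = PowerSeries.mk 1 ^ n := by
  cases n with
  | zero =>
    ext k
    rw [generatingSeries, PowerSeries.coeff_mk, hilbertFunction, polyGrading_natCast,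
      finrank_homogeneousSubmodule, pow_zero, PowerSeries.coeff_one]
    cases k <;> simp
  | succ n =>
    ext k
    rw [PowerSeries.mk_one_pow_eq_mk_choose_add, generatingSeries, PowerSeries.coeff_mk,
      PowerSeries.coeff_mk, hilbertFunction, polyGrading_natCast,
      finrank_homogeneousSubmodule, Nat.multichoose_eq,
      show n + 1 + k - 1 = n + k by omega, Nat.choose_symm_add]

theorem hilbertFunction_quotientGrading_bot :
    hilbertFunction (quotientGrading (⊥ : Ideal (MvPolynomial (Fin n) K))) =
      hilbertFunction (polyGrading K n) := by
  funext k
  refine (LinearEquiv.finrank_eq (Submodule.equivMapOfInjective _ ?_ _)).symm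
  intro a b hab
  exact sub_eq_zero.mp ((Submodule.mem_bot _).mp (Ideal.Quotient.eq.mp hab))

theorem mul_mem_polyGrading {f s : MvPolynomial (Fin n) K} {d : ℕ} (hf : f.IsHomogeneous d)
    {k : ℤ} (hs : s ∈ polyGrading K n (k - d)) : f * s ∈ polyGrading K n k := by
  by_cases hk : 0 ≤ k - d
  · obtain ⟨m, hm⟩ := Int.eq_ofNat_of_zero_le hk
    obtain rfl : k = ((d + m : ℕ) : ℤ) := by omega
    rw [hm, polyGrading_natCast] at hs
    rw [polyGrading_natCast]
    exact hf.mul hs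
  · rw [polyGrading_of_neg (not_le.mp hk), Submodule.mem_bot] at hs
    simp [hs]

/-- A homogeneous element of `J + (f)` is congruent modulo `J` to a homogeneous multiple of `f`. -/
theorem exists_mul_sub_mem {J : Ideal (MvPolynomial (Fin n) K)}
    (hJ : J.IsHomogeneous (homogeneousSubmodule (Fin n) K)) {f : MvPolynomial (Fin n) K} {d : ℕ}
    (hf : f.IsHomogeneous d) {k : ℤ} {g : MvPolynomial (Fin n) K} (hg : g ∈ polyGrading K n k)
    (hgJ : g ∈ J ⊔ Ideal.span {f}) : ∃ s ∈ polyGrading K n (k - d), g - f * s ∈ J := by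
  by_cases hk : 0 ≤ k
  · lift k to ℕ using hk
    rw [polyGrading_natCast] at hg
    obtain ⟨j, hj, y, hy, rfl⟩ := Submodule.mem_sup.mp hgJ
    obtain ⟨s, rfl⟩ := Ideal.mem_span_singleton'.mp hy
    -- Compare degree-`k` components in `g = j + f s`: that of `j` stays in `J`, and that of `f s`
    -- is `f` times a component of `s`, or zero if `k < d`.
    have hcomp := DirectSum.decompose_of_mem_same (homogeneousSubmodule (Fin n) K) hg
    rw [DirectSum.decompose_add, DirectSum.add_apply, Submodule.coe_add, mul_comm s f,
      DirectSum.coe_decompose_mul_of_left_mem (homogeneousSubmodule (Fin n) K) k hf] at hcomp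
    have hjk := hJ k hj
    rw [mul_comm s f, ← hcomp]
    split_ifs with hdk
    · refine ⟨DirectSum.decompose (homogeneousSubmodule (Fin n) K) s (k - d), ?_,
        by simpa using hjk⟩
      rw [← Nat.cast_sub hdk, polyGrading_natCast]
      exact SetLike.coe_mem _
    · exact ⟨0, Submodule.zero_mem _, by simpa using hjk⟩
  · rw [polyGrading_of_neg (not_le.mp hk), Submodule.mem_bot] at hg
    exact ⟨0, Submodule.zero_mem _, by simp [hg]⟩

/-- The exact sequence `0 → (S/J)(-d) → S/J → S/(J + (f)) → 0` for `f` of degree `d` regular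
on `S/J`. -/
theorem hilbertFunction_quotientGrading_sup {J : Ideal (MvPolynomial (Fin n) K)}
    (hJ : J.IsHomogeneous (homogeneousSubmodule (Fin n) K)) {f : MvPolynomial (Fin n) K} {d : ℕ}
    (hf : f.IsHomogeneous d) (hreg : ∀ s, f * s ∈ J → s ∈ J) (k : ℤ) :
    hilbertFunction (quotientGrading J) k =
      hilbertFunction (quotientGrading (J ⊔ Ideal.span {f})) k +
        hilbertFunction (quotientGrading J) (k - d) := by
  set π := (Ideal.Quotient.mkₐ K J).toLinearMap with hπ
  set J' := J ⊔ Ideal.span {f} with hJ'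
  let ψ : (MvPolynomial (Fin n) K ⧸ J) →ₗ[K] (MvPolynomial (Fin n) K ⧸ J') :=
    (Ideal.Quotient.factorₐ K (le_sup_left : J ≤ J')).toLinearMap
  let μ : (MvPolynomial (Fin n) K ⧸ J) →ₗ[K] (MvPolynomial (Fin n) K ⧸ J) :=
    LinearMap.mulLeft K (Ideal.Quotient.mk J f)
  have hψπ : ψ ∘ₗ π = (Ideal.Quotient.mkₐ K J').toLinearMap := rfl
  have hμ : Function.Injective μ := by
    rw [← LinearMap.ker_eq_bot, LinearMap.ker_eq_bot']
    intro x hx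
    obtain ⟨s, rfl⟩ := Ideal.Quotient.mk_surjective x
    rw [LinearMap.mulLeft_apply, ← map_mul, Ideal.Quotient.eq_zero_iff_mem] at hx
    exact Ideal.Quotient.eq_zero_iff_mem.mpr (hreg s hx)
  have hfin : Module.Finite K (quotientGrading J k) := by
    rw [quotientGrading]; infer_instance
  have hrange : (ψ.domRestrict (quotientGrading J k)).range = quotientGrading J' k := by
    rw [LinearMap.range_domRestrict, quotientGrading, ← Submodule.map_comp]
    rfl
  have hker : (ψ.domRestrict (quotientGrading J k)).ker.map (quotientGrading J k).subtype =
      (quotientGrading J (k - d)).map μ := by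
    ext x
    constructor
    · rintro ⟨⟨_, g, hg, rfl⟩, hx, rfl⟩
      have hgJ : g ∈ J' := Ideal.Quotient.eq_zero_iff_mem.mp hx
      obtain ⟨s, hs, hgs⟩ := exists_mul_sub_mem hJ hf hg hgJ
      exact ⟨_, ⟨s, hs, rfl⟩, (Ideal.Quotient.eq.mpr hgs).symm⟩
    · rintro ⟨_, ⟨s, hs, rfl⟩, rfl⟩
      refine ⟨⟨π (f * s), f * s, mul_mem_polyGrading hf hs, rfl⟩, ?_, ?_⟩
      · refine Ideal.Quotient.eq_zero_iff_mem.mpr (Ideal.mul_mem_right _ _ ?_)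
        exact Ideal.mem_sup_right (Ideal.mem_span_singleton_self f)
      · exact map_mul (Ideal.Quotient.mk J) f s
  have hrank := (ψ.domRestrict (quotientGrading J k)).finrank_range_add_finrank_ker
  have hkr := LinearEquiv.finrank_eq (Submodule.equivMapOfInjective
    (quotientGrading J k).subtype (Submodule.subtype_injective _)
    (ψ.domRestrict (quotientGrading J k)).ker)
  rw [hker, ← LinearEquiv.finrank_eq (Submodule.equivMapOfInjective μ hμ _)] at hkr
  rw [hrange, hkr] at hrank
  exact hrank.symm

theorem generatingSeries_quotientGrading_sup {J : Ideal (MvPolynomial (Fin n) K)}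
    (hJ : J.IsHomogeneous (homogeneousSubmodule (Fin n) K)) {f : MvPolynomial (Fin n) K} {d : ℕ}
    (hf : f.IsHomogeneous d) (hreg : ∀ s, f * s ∈ J → s ∈ J) :
    generatingSeries (hilbertFunction (quotientGrading (J ⊔ Ideal.span {f}))) =
      generatingSeries (hilbertFunction (quotientGrading J)) * (1 - PowerSeries.X ^ d) := by
  ext k
  rw [mul_sub, mul_one, map_sub, mul_comm, PowerSeries.coeff_X_pow_mul']
  simp only [generatingSeries, PowerSeries.coeff_mk]
  have h := hilbertFunction_quotientGrading_sup hJ hf hreg k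
  split_ifs with hdk
  · rw [Nat.cast_sub hdk]
    omega
  · rw [hilbertFunction_quotientGrading_of_neg J (k := k - d) (by omega)] at h
    omega

/-- Induction from the end of the list, since each element is regular modulo its predecessors. -/
theorem generatingSeries_quotientGrading_ofList {rs : List (MvPolynomial (Fin n) K)}
    (hhom : ∀ f ∈ rs, f.IsHomogeneous f.totalDegree)
    (hreg : RingTheory.Sequence.IsWeaklyRegular (MvPolynomial (Fin n) K) rs) :
    generatingSeries (hilbertFunction (quotientGrading (Ideal.ofList rs))) =
      PowerSeries.mk 1 ^ n *
        (rs.map fun f => (1 - PowerSeries.X ^ f.totalDegree : PowerSeries ℤ)).prod := by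
  induction rs using List.reverseRecOn with
  | nil =>
    rw [Ideal.ofList_nil, hilbertFunction_quotientGrading_bot, generatingSeries_polyGrading]
    simp
  | append_singleton rs f ih =>
    obtain ⟨hrs, hf⟩ := (RingTheory.Sequence.isWeaklyRegular_append_iff _ rs [f]).mp hreg
    rw [RingTheory.Sequence.isWeaklyRegular_singleton_iff] at hf
    have hJ : (Ideal.ofList rs).IsHomogeneous (homogeneousSubmodule (Fin n) K) :=
      Ideal.homogeneous_span _ _ fun g hg =>
        ⟨g.totalDegree, hhom g (List.mem_append_left _ hg)⟩
    rw [Ideal.ofList_append, Ideal.ofList_singleton,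
      generatingSeries_quotientGrading_sup hJ (hhom f (by simp)),
      ih (fun g hg => hhom g (List.mem_append_left _ hg)) hrs]
    · simp [mul_assoc]
    · intro s hs
      have htop : (Ideal.ofList rs • ⊤ : Submodule (MvPolynomial (Fin n) K) _) =
        Ideal.ofList rs := by simp
      have := hf.right_eq_zero_of_smul (x := Submodule.Quotient.mk s)
      rw [← Submodule.Quotient.mk_smul, Submodule.Quotient.mk_eq_zero,
        Submodule.Quotient.mk_eq_zero, htop] at this
      exact this hs

end HilbertSeries

/-! ### Factoring the Hilbert series -/

theorem mk_one_eq_one_add_X_add :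
    (PowerSeries.mk 1 : PowerSeries ℤ) =
      1 + PowerSeries.X + PowerSeries.X ^ 2 * PowerSeries.mk 1 := by
  linear_combination (1 + PowerSeries.X) * PowerSeries.mk_one_mul_one_sub_eq_one ℤ

/-- `(1 - X^d)/(1 - X) = 1 + X + X^2 (1 + ⋯ + X^{d-3})`. -/
theorem mk_one_mul_one_sub_X_pow {d : ℕ} (hd : 2 ≤ d) :
    (PowerSeries.mk 1 : PowerSeries ℤ) * (1 - PowerSeries.X ^ d) =
      1 + PowerSeries.X + PowerSeries.X ^ 2 * ∑ i ∈ Finset.range (d - 2), PowerSeries.X ^ i := by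
  obtain ⟨e, rfl⟩ := Nat.exists_eq_add_of_le hd
  have hgeom := geom_sum_mul_neg (PowerSeries.X : PowerSeries ℤ) (2 + e)
  rw [← hgeom, mul_comm, mul_assoc, mul_comm (1 - PowerSeries.X),
    PowerSeries.mk_one_mul_one_sub_eq_one, mul_one, Finset.sum_range_add]
  simp [Finset.sum_range_succ, pow_add, Finset.mul_sum]

theorem hasPositiveBeta_mk_one_pow (m : ℕ) :
    HasPositiveBeta m (PowerSeries.mk 1 ^ m : PowerSeries ℤ) := by
  induction m with
  | zero => simpa using hasPositiveBeta_one
  | succ m ih =>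
    rw [pow_succ]
    nth_rw 2 [mk_one_eq_one_add_X_add]
    exact ih.mul fun k => by simp

/-- Each `1 - X^d` is paired with its own `1/(1 - X)`, leaving `m` unpaired copies. -/
theorem hasPositiveBeta_mul_prod (m : ℕ) {ds : List ℕ} (hds : ∀ d ∈ ds, 2 ≤ d) :
    HasPositiveBeta (m + ds.length) (PowerSeries.mk 1 ^ (m + ds.length) *
      (ds.map fun d => (1 - PowerSeries.X ^ d : PowerSeries ℤ)).prod) := by
  induction ds with
  | nil => simpa using hasPositiveBeta_mk_one_pow m
  | cons d ds ih =>
    have := (ih fun e he => hds e (List.mem_cons_of_mem _ he)).mul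
      (R := ∑ i ∈ Finset.range (d - 2), PowerSeries.X ^ i) fun k => by
        rw [map_sum]
        refine Finset.sum_nonneg fun i _ => ?_
        rw [PowerSeries.coeff_X_pow]
        split_ifs <;> simp
    rw [← mk_one_mul_one_sub_X_pow (hds d (by simp))] at this
    rw [List.length_cons, List.map_cons, List.prod_cons, ← add_assoc]
    convert this using 1
    ring

theorem corollary3p2 (K : Type*) [Field K] (n : ℕ) :
    (∀ (r : ℕ), r ≤ n →
      ∀ (f : Fin r → MvPolynomial (Fin n) K) (J : Ideal (MvPolynomial (Fin n) K)),
        IsGradedCompleteIntersection J f →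
        (∀ i, 2 ≤ (f i).totalDegree) →
        IsGreatest (hilbertDepthSet (hilbertFunction (quotientGrading J)))
            (qdepth (hilbertFunction (quotientGrading J))) ∧
          qdepth (hilbertFunction (quotientGrading J)) = (n : ℤ)) ∧
    (IsGreatest (hilbertDepthSet (hilbertFunction (polyGrading K n)))
        (qdepth (hilbertFunction (polyGrading K n))) ∧
      qdepth (hilbertFunction (polyGrading K n)) = (n : ℤ)) := by
  have key : ∀ h : ℤ → ℕ, IsGreatest (hilbertDepthSet h) (n : ℤ) →
      IsGreatest (hilbertDepthSet h) (qdepth h) ∧ qdepth h = n := by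
    intro h hh
    have hq : qdepth h = n := hh.csSup_eq
    exact ⟨hq ▸ hh, hq⟩
  refine ⟨fun r hr f J hJ hdeg => key _ ?_, key _ ?_⟩
  · refine isGreatest_hilbertDepthSet
      (fun k hk => hilbertFunction_quotientGrading_of_neg J hk) ?_
    have hspan : J = Ideal.ofList (List.ofFn f) := by
      rw [hJ.span_eq, Ideal.ofList]
      congr 1
      ext g
      simp [List.mem_ofFn]
    have hhom : ∀ g ∈ List.ofFn f, g.IsHomogeneous g.totalDegree := by
      intro g hg
      obtain ⟨i, rfl⟩ := List.mem_ofFn.mp hg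
      exact hJ.homogeneous i
    rw [hspan, generatingSeries_quotientGrading_ofList hhom hJ.regular.toIsWeaklyRegular]
    have := hasPositiveBeta_mul_prod (n - r) (ds := (List.ofFn f).map totalDegree) (by
      intro d hd
      obtain ⟨g, hg, rfl⟩ := List.mem_map.mp hd
      obtain ⟨i, rfl⟩ := List.mem_ofFn.mp hg
      exact hdeg i)
    rw [List.length_map, List.length_ofFn, Nat.sub_add_cancel hr, List.map_map] at this
    exact this
  · refine isGreatest_hilbertDepthSet (fun k hk => hilbertFunction_polyGrading_of_neg hk) ?_
    rw [generatingSeries_polyGrading]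
    exact hasPositiveBeta_mk_one_pow n
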